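/- Let $M_n$ denote the $n$-th Motzkin number, i.e. the number of sequences $(s_1,\dots,s_n)\in\{-1,0,1\}^n$ all of whose partial sums $s_1+\cdots+s_k$ ($0\le k\le n$) are non-negative and whose total sum is $0$. For a sequence $\{a_n\}_{n\ge 0}$ of real numbers put $(\mathscr{L}a)_n = a_n a_{n+2}-a_{n+1}^2$ and $\mathscr{L}^{k}a=\mathscr{L}(\mathscr{L}^{k-1}a)$, with $\mathscr{L}^0a=a$. The sequence $\{a_n\}_{n\ge0}$ is called asymptotically $r$-log-convex if there is an $N$ such that $(\mathscr{L}^k a)_n\ge 0$ for all $1\le k\le r$ and all $n\ge N$. Then for every positive integer $r$, the sequence $\{M_n\}_{n\ge 0}$ is asymptotically $r$-log-convex. -/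

import Mathlib

/-- The operator `𝓛` on real sequences: `(𝓛 a) n = a n * a (n + 2) - a (n + 1) ^ 2`. -/
def logConvOp (a : ℕ → ℝ) : ℕ → ℝ :=
  fun n => a n * a (n + 2) - a (n + 1) ^ 2

/-- A real sequence `a` is asymptotically `r`-log-convex if the sequences
`𝓛 a, 𝓛² a, …, 𝓛ʳ a` are all non-negative for `n` sufficiently large. -/
def AsymptoticallyRLogConvex (r : ℕ) (a : ℕ → ℝ) : Prop :=
  ∃ N : ℕ, ∀ n ≥ N, ∀ k : ℕ, 1 ≤ k → k ≤ r → 0 ≤ (logConvOp^[k] a) n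

/-- A sequence of `n` steps, each of which is `-1` (down), `0` (level) or `1` (up), is a Motzkin
path if the height never becomes negative and the final height is `0`.
The height after `k` steps is the sum of the first `k` steps. -/
def IsMotzkinPath {n : ℕ} (s : Fin n → SignType) : Prop :=
  (∀ k ≤ n, 0 ≤ ∑ i : Fin n with i.val < k, (s i : ℤ)) ∧ ∑ i : Fin n, (s i : ℤ) = 0

instance decidableIsMotzkinPath {n : ℕ} (s : Fin n → SignType) : Decidable (IsMotzkinPath s) := by
  unfold IsMotzkinPath
  infer_instance

/-- The `n`-th Motzkin number: the number of Motzkin paths with `n` steps. -/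
def motzkinNumber (n : ℕ) : ℕ :=
  Fintype.card {s : Fin n → SignType // IsMotzkinPath s}

/-! Motzkin numbers are the moments of the law of `1 + 2 cos θ` under `(2/π) sin² θ dθ` on `[0, π]`,
which lives on `[-1, 3]`. If `a` has moment measure `μ`, then `(𝓛 a) n = ∬ (x - y)² / 2 * (x y)^n dμ
dμ`, so `𝓛 a` is again a moment sequence, with variable `x y`. If `μ` lives on `[-A, B]`, the new
measure lives on `[-A B, B²]`, and `A < B` persists. Mass near the right end then outweighs any
negative contribution for large `n`, at every iterate. -/

open MeasureTheory Filter Topology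

/-! ### Moment sequences and the operator `𝓛` -/

/-- `a` is the moment sequence of a finite measure on an interval `[-A, B]` with `A < B`, the
measure having mass arbitrarily close to the left of `B`. -/
def IsTopHeavyMoments (a : ℕ → ℝ) : Prop :=
  ∃ (μ : Measure ℝ) (A B : ℝ), IsFiniteMeasure μ ∧ 0 ≤ A ∧ A < B ∧
    (∀ᵐ x ∂μ, x ∈ Set.Icc (-A) B) ∧ (∀ c < B, 0 < μ (Set.Ioo c B)) ∧
    ∀ n, a n = ∫ x, x ^ n ∂μ

lemma integrable_pow_of_ae_mem_Icc {μ : Measure ℝ} [IsFiniteMeasure μ] {A B : ℝ}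
    (h : ∀ᵐ x ∂μ, x ∈ Set.Icc A B) (n : ℕ) : Integrable (fun x => x ^ n) μ := by
  refine Integrable.of_bound (by fun_prop) ((max |A| |B|) ^ n) ?_
  filter_upwards [h] with x hx
  rw [norm_pow, Real.norm_eq_abs]
  exact pow_le_pow_left₀ (abs_nonneg _) (abs_le_max_abs_abs hx.1 hx.2) n

/-- For `A < c < B`, `x ^ n ≥ c ^ n * 1_(c,B) - A ^ n` on `[-A, B]`. After integration the `c ^ n`
term dominates. -/
lemma IsTopHeavyMoments.eventually_nonneg {a : ℕ → ℝ} (h : IsTopHeavyMoments a) :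
    ∀ᶠ n in atTop, 0 ≤ a n := by
  obtain ⟨μ, A, B, hμ, hA, hAB, hmem, hpos, ha⟩ := h
  obtain ⟨c, hAc, hcB⟩ := exists_between hAB
  have hc : 0 < c := hA.trans_lt hAc
  have hδ : 0 < μ.real (Set.Ioo c B) :=
    ENNReal.toReal_pos (hpos c hcB).ne' (measure_ne_top _ _)
  have hlow : ∀ n, c ^ n * μ.real (Set.Ioo c B) - A ^ n * μ.real Set.univ ≤ a n := by
    intro n
    have hi : Integrable ((Set.Ioo c B).indicator fun _ : ℝ => c ^ n) μ :=
      (integrable_const _).indicator measurableSet_Ioo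
    have : ∫ x, ((Set.Ioo c B).indicator (fun _ => c ^ n) x - A ^ n) ∂μ ≤ ∫ x, x ^ n ∂μ := by
      refine integral_mono_ae (hi.sub (integrable_const _))
        (integrable_pow_of_ae_mem_Icc hmem n) ?_
      filter_upwards [hmem] with x hx
      have hAn : 0 ≤ A ^ n := pow_nonneg hA n
      by_cases hxc : x ∈ Set.Ioo c B
      · simp only [Set.indicator_of_mem hxc]
        have := pow_le_pow_left₀ hc.le hxc.1.le n
        linarith
      · simp only [Set.indicator_of_notMem hxc]
        rcases le_or_gt 0 x with h0 | h0
        · have := pow_nonneg h0 n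
          linarith
        · have h1 : |x ^ n| ≤ A ^ n := by
            rw [abs_pow]
            exact pow_le_pow_left₀ (abs_nonneg _) (by rw [abs_of_neg h0]; linarith [hx.1]) n
          linarith [(abs_le.1 h1).1]
    rw [integral_sub hi (integrable_const _), integral_indicator measurableSet_Ioo,
      setIntegral_const, integral_const, smul_eq_mul, smul_eq_mul] at this
    rw [ha n]
    linarith [mul_comm (c ^ n) (μ.real (Set.Ioo c B)), mul_comm (A ^ n) (μ.real Set.univ)]
  have hlim : Tendsto (fun n : ℕ => (A / c) ^ n * μ.real Set.univ) atTop (𝓝 0) := by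
    simpa using (tendsto_pow_atTop_nhds_zero_of_lt_one (div_nonneg hA hc.le)
      ((div_lt_one hc).2 hAc)).mul_const (μ.real Set.univ)
  filter_upwards [hlim.eventually (gt_mem_nhds hδ)] with n hn
  refine le_trans ?_ (hlow n)
  have hcn : 0 < c ^ n := pow_pos hc n
  have := mul_lt_mul_of_pos_left hn hcn
  rw [div_pow, ← mul_assoc, mul_div_cancel₀ _ hcn.ne'] at this
  linarith

/-- Continuity from below. This splits the mass near `B` between two disjoint intervals, so the
factor `(x - y)²` cannot kill all of it. -/
lemma exists_measure_Ioo_pos {μ : Measure ℝ} {d B : ℝ} (h : 0 < μ (Set.Ioo d B)) :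
    ∃ e < B, 0 < μ (Set.Ioo d e) := by
  by_contra! hcon
  obtain ⟨u, -, hu, hlim⟩ := exists_seq_strictMono_tendsto B
  refine h.ne' (measure_mono_null (t := ⋃ n, Set.Ioo d (u n)) ?_
    (measure_iUnion_null fun n => le_antisymm (hcon _ (hu n)) zero_le))
  intro x hx
  obtain ⟨n, hn⟩ := (hlim.eventually (lt_mem_nhds hx.2)).exists
  exact Set.mem_iUnion.2 ⟨n, hx.1, hn⟩

lemma integral_mul_pow_mul_sq_sub {μ : Measure ℝ} [IsFiniteMeasure μ]
    (hi : ∀ n : ℕ, Integrable (fun x : ℝ => x ^ n) μ) (n : ℕ) :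
    Integrable (fun p : ℝ × ℝ => (p.1 - p.2) ^ 2 / 2 * (p.1 * p.2) ^ n) (μ.prod μ) ∧
    ∫ p : ℝ × ℝ, (p.1 - p.2) ^ 2 / 2 * (p.1 * p.2) ^ n ∂(μ.prod μ) =
      logConvOp (fun m => ∫ x, x ^ m ∂μ) n := by
  have hint : ∀ i j : ℕ, Integrable (fun p : ℝ × ℝ => p.1 ^ i * p.2 ^ j) (μ.prod μ) :=
    fun i j => (hi i).mul_prod (hi j)
  have heq : (fun p : ℝ × ℝ => (p.1 - p.2) ^ 2 / 2 * (p.1 * p.2) ^ n) = fun p =>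
      (1 / 2 * (p.1 ^ (n + 2) * p.2 ^ n) + 1 / 2 * (p.1 ^ n * p.2 ^ (n + 2))) -
        p.1 ^ (n + 1) * p.2 ^ (n + 1) := by
    funext p
    ring
  have h1 := (hint (n + 2) n).const_mul (1 / 2)
  have h2 := (hint n (n + 2)).const_mul (1 / 2)
  rw [heq]
  refine ⟨(h1.add h2).sub (hint _ _), ?_⟩
  rw [integral_sub (by exact h1.add h2) (hint _ _), integral_add h1 h2, integral_const_mul,
    integral_const_mul, integral_prod_mul (fun x : ℝ => x ^ (n + 2)) (fun x : ℝ => x ^ n),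
    integral_prod_mul (fun x : ℝ => x ^ n) (fun x : ℝ => x ^ (n + 2)),
    integral_prod_mul (fun x : ℝ => x ^ (n + 1)) (fun x : ℝ => x ^ (n + 1)), logConvOp]
  ring

lemma IsTopHeavyMoments.logConvOp {a : ℕ → ℝ} (h : IsTopHeavyMoments a) :
    IsTopHeavyMoments (logConvOp a) := by
  obtain ⟨μ, A, B, hμ, hA, hAB, hmem, hpos, ha⟩ := h
  have hB : 0 < B := hA.trans_lt hAB
  have hm := integral_mul_pow_mul_sq_sub (integrable_pow_of_ae_mem_Icc hmem)
  set f : ℝ × ℝ → ENNReal := fun p => ENNReal.ofReal ((p.1 - p.2) ^ 2 / 2) with hf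
  have hfm : Measurable f := by fun_prop
  set ν := (μ.prod μ).withDensity f with hν
  have hmul : Measurable fun p : ℝ × ℝ => p.1 * p.2 := by fun_prop
  have hfin : IsFiniteMeasure ν := by
    refine isFiniteMeasure_withDensity_ofReal ?_
    simpa using (hm 0).1.2
  refine ⟨ν.map fun p => p.1 * p.2, A * B, B ^ 2, inferInstance, by positivity,
    by nlinarith, ?_, ?_, ?_⟩
  · refine (ae_map_iff hmul.aemeasurable measurableSet_Icc).2 ?_
    refine (withDensity_absolutelyContinuous _ _).ae_le ?_
    filter_upwards [Measure.quasiMeasurePreserving_fst.ae hmem,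
      Measure.quasiMeasurePreserving_snd.ae hmem] with p h1 h2
    obtain ⟨h1l, h1r⟩ := h1
    obtain ⟨h2l, h2r⟩ := h2
    constructor
    · rcases le_total 0 p.1 with h | h <;> nlinarith
    · have e1 : |p.1| ≤ B := abs_le.2 ⟨by linarith, h1r⟩
      have e2 : |p.2| ≤ B := abs_le.2 ⟨by linarith, h2r⟩
      calc p.1 * p.2 ≤ |p.1 * p.2| := le_abs_self _
        _ = |p.1| * |p.2| := abs_mul _ _
        _ ≤ B * B := mul_le_mul e1 e2 (abs_nonneg _) hB.le
        _ = B ^ 2 := (sq B).symm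
  · intro c hc
    -- For negative `c`, `√c = 0` still works.
    obtain ⟨d, hd0, hdB, hdc⟩ : ∃ d, 0 ≤ d ∧ d < B ∧ c ≤ d * d := by
      refine ⟨√c, Real.sqrt_nonneg _, (Real.sqrt_lt' hB).2 hc, ?_⟩
      rcases le_total 0 c with h | h
      · exact (Real.mul_self_sqrt h).ge
      · exact h.trans (mul_self_nonneg _)
    obtain ⟨e, heB, he⟩ := exists_measure_Ioo_pos (hpos d hdB)
    rw [Measure.map_apply hmul measurableSet_Ioo, pos_iff_ne_zero, hν, Ne,
      withDensity_apply_eq_zero hfm]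
    intro h0
    have hde : d < e := by
      by_contra hcon
      simp [Set.Ioo_eq_empty hcon] at he
    have hsub : Set.Ioo d e ×ˢ Set.Ioo e B ⊆
        {p | f p ≠ 0} ∩ (fun p : ℝ × ℝ => p.1 * p.2) ⁻¹' Set.Ioo c (B ^ 2) := by
      -- `x < e < y` keeps the rectangle off the diagonal, where the density vanishes; both factors
      -- lie in `(d, B)`, so the product exceeds `d * d ≥ c`.
      rintro ⟨x, y⟩ ⟨⟨hx1, hx2⟩, hy1, hy2⟩
      simp only at hx1 hx2 hy1 hy2
      refine ⟨?_, ?_, ?_⟩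
      · have : 0 < (x - y) ^ 2 / 2 := by
          have : x - y ≠ 0 := by linarith
          positivity
        simpa [hf] using this
      · simp only
        nlinarith
      · simp only
        nlinarith
    have := measure_mono_null hsub h0
    rw [Measure.prod_prod] at this
    exact mul_ne_zero he.ne' (hpos e heB).ne' this
  · intro n
    rw [integral_map hmul.aemeasurable (by fun_prop), hν,
      integral_withDensity_eq_integral_toReal_smul hfm (by simp [hf]), funext ha, ← (hm n).2]
    refine integral_congr_ae (.of_forall fun p => ?_)
    simp only [hf, smul_eq_mul]
    rw [ENNReal.toReal_ofReal (by positivity)]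

lemma IsTopHeavyMoments.iterate_logConvOp {a : ℕ → ℝ} (h : IsTopHeavyMoments a) (k : ℕ) :
    IsTopHeavyMoments (_root_.logConvOp^[k] a) := by
  induction k with
  | zero => exact h
  | succ k ih =>
    rw [Function.iterate_succ_apply']
    exact ih.logConvOp

/-! ### First-step recursion for Motzkin paths -/

/-- A path starting at height `h` that stays non-negative and ends at height `0`. -/
def IsMotzkinPathFrom (h : ℤ) {n : ℕ} (s : Fin n → SignType) : Prop :=
  (∀ k ≤ n, 0 ≤ h + ∑ i : Fin n with i.val < k, (s i : ℤ)) ∧ h + ∑ i : Fin n, (s i : ℤ) = 0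

instance decidableIsMotzkinPathFrom (h : ℤ) {n : ℕ} (s : Fin n → SignType) :
    Decidable (IsMotzkinPathFrom h s) := by
  unfold IsMotzkinPathFrom
  infer_instance

/-- The number of Motzkin paths with `n` steps from height `h` to height `0`. -/
def motzkinCount (n : ℕ) (h : ℤ) : ℕ :=
  Fintype.card {s : Fin n → SignType // IsMotzkinPathFrom h s}

lemma motzkinCount_zero_right (n : ℕ) : motzkinCount n 0 = motzkinNumber n :=
  Fintype.card_congr (Equiv.subtypeEquivRight fun s => by
    simp [IsMotzkinPathFrom, IsMotzkinPath])

lemma motzkinCount_of_neg (n : ℕ) {h : ℤ} (hh : h < 0) : motzkinCount n h = 0 := by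
  refine Fintype.card_eq_zero_iff.2 ⟨fun s => ?_⟩
  have := s.2.1 0 n.zero_le
  simp at this
  omega

lemma motzkinCount_zero_left (h : ℤ) :
    motzkinCount 0 h = if h = 0 then 1 else 0 := by
  unfold motzkinCount
  split_ifs with h0
  · refine Fintype.card_eq_one_iff.2 ⟨⟨Fin.elim0, by simp [IsMotzkinPathFrom, h0]⟩, fun y => ?_⟩
    exact Subsingleton.elim _ _
  · refine Fintype.card_eq_zero_iff.2 ⟨fun s => h0 ?_⟩
    simpa using s.2.2

lemma isMotzkinPathFrom_cons {h : ℤ} (hh : 0 ≤ h) {n : ℕ} (a : SignType)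
    (s : Fin n → SignType) :
    IsMotzkinPathFrom h (Fin.cons a s : Fin (n + 1) → SignType) ↔
      IsMotzkinPathFrom (h + (a : ℤ)) s := by
  have key : ∀ k, ∑ i : Fin (n + 1) with i.val < k + 1,
      (((Fin.cons a s : Fin (n + 1) → SignType) i : SignType) : ℤ) =
        a + ∑ i : Fin n with i.val < k, (s i : ℤ) := by
    intro k
    simp [Finset.sum_filter, Fin.sum_univ_succ]
  unfold IsMotzkinPathFrom
  rw [Fin.sum_univ_succ]
  simp only [Fin.cons_zero, Fin.cons_succ]
  rw [← add_assoc]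
  refine and_congr_left fun _ => ⟨fun H k hk => ?_, fun H k hk => ?_⟩
  · have := H (k + 1) (by omega)
    rwa [key, ← add_assoc] at this
  · cases k with
    -- The empty prefix has no counterpart in the shorter path; `0 ≤ h` covers it.
    | zero => simpa using hh
    | succ k =>
      rw [key, ← add_assoc]
      exact H k (by omega)

lemma motzkinCount_succ (n : ℕ) {h : ℤ} (hh : 0 ≤ h) :
    motzkinCount (n + 1) h =
      motzkinCount n (h - 1) + motzkinCount n h + motzkinCount n (h + 1) := by
  have e : {s : Fin (n + 1) → SignType // IsMotzkinPathFrom h s} ≃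
      Σ a : SignType, {s : Fin n → SignType // IsMotzkinPathFrom (h + (a : ℤ)) s} :=
    ((Fin.consEquiv fun _ => SignType).subtypeEquiv
      (p := fun x : SignType × (Fin n → SignType) => IsMotzkinPathFrom (h + (x.1 : ℤ)) x.2)
      fun x => (isMotzkinPathFrom_cons hh x.1 x.2).symm).symm.trans
      (Equiv.subtypeProdEquivSigmaSubtype fun (a : SignType) (s : Fin n → SignType) =>
        IsMotzkinPathFrom (h + (a : ℤ)) s)
  have hu : (Finset.univ : Finset SignType) = {-1, 0, 1} := by decide
  have hcard : motzkinCount (n + 1) h = ∑ a : SignType, motzkinCount n (h + (a : ℤ)) :=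
    (Fintype.card_congr e).trans Fintype.card_sigma
  rw [hcard, hu,
    Finset.sum_insert (by decide), Finset.sum_insert (by decide), Finset.sum_singleton]
  simp only [SignType.coe_neg_one, SignType.coe_zero, SignType.coe_one, add_zero, ← sub_eq_add_neg,
    add_assoc]

/-! ### Integral representation of Motzkin numbers -/

lemma integral_sin_mul_sin_add_one {m : ℤ} (hm : 0 ≤ m) :
    ∫ θ in (0 : ℝ)..Real.pi, Real.sin θ * Real.sin ((m + 1) * θ) =
      if m = 0 then Real.pi / 2 else 0 := by
  have hcos : ∀ k : ℤ, k ≠ 0 → ∫ θ in (0 : ℝ)..Real.pi, Real.cos (k * θ) = 0 := by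
    intro k hk
    rw [intervalIntegral.integral_comp_mul_left _ (Int.cast_ne_zero.2 hk), integral_cos]
    simp [Real.sin_int_mul_pi]
  have hrw : ∀ θ : ℝ, Real.sin θ * Real.sin ((m + 1) * θ) =
      1 / 2 * Real.cos ((m : ℤ) * θ) - 1 / 2 * Real.cos (((m + 2 : ℤ) : ℝ) * θ) := by
    intro θ
    have h1 : (m : ℝ) * θ = (m + 1) * θ - θ := by ring
    have h2 : ((m + 2 : ℤ) : ℝ) * θ = (m + 1) * θ + θ := by push_cast; ring
    rw [h1, h2, Real.cos_sub, Real.cos_add]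
    ring
  simp only [hrw]
  rw [intervalIntegral.integral_sub
      ((by fun_prop : Continuous _).intervalIntegrable _ _)
      ((by fun_prop : Continuous _).intervalIntegrable _ _),
    intervalIntegral.integral_const_mul, intervalIntegral.integral_const_mul,
    hcos (m + 2) (by omega)]
  split_ifs with h0
  · simp [h0]
    ring
  · simp [hcos m h0]

/-- Multiplying `sin ((h + 1) θ)` by `1 + 2 cos θ` sums its values at `h - 1`, `h`, `h + 1`,
matching the path recursion. Both sides vanish at `h = -1`, the boundary value needed when `h = 0`.
-/
lemma motzkinCount_eq_integral (n : ℕ) {h : ℤ} (hh : -1 ≤ h) :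
    (motzkinCount n h : ℝ) = 2 / Real.pi * ∫ θ in (0 : ℝ)..Real.pi,
      (1 + 2 * Real.cos θ) ^ n * (Real.sin θ * Real.sin ((h + 1) * θ)) := by
  induction n generalizing h with
  | zero =>
    rcases hh.eq_or_lt with rfl | hh
    · simp [motzkinCount_of_neg]
    · have h0 : 0 ≤ h := by omega
      simp only [pow_zero, one_mul]
      rw [motzkinCount_zero_left h, integral_sin_mul_sin_add_one h0]
      split_ifs
      · push_cast
        field_simp [Real.pi_ne_zero]
      · simp
  | succ n ih =>
    rcases hh.eq_or_lt with rfl | hh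
    · simp [motzkinCount_of_neg]
    · rw [motzkinCount_succ n (by omega : 0 ≤ h)]
      push_cast
      rw [ih (by omega : -1 ≤ h - 1), ih (by omega : -1 ≤ h), ih (by omega : -1 ≤ h + 1),
        ← mul_add, ← intervalIntegral.integral_add
          ((by fun_prop : Continuous _).intervalIntegrable _ _)
          ((by fun_prop : Continuous _).intervalIntegrable _ _), ← mul_add,
        ← intervalIntegral.integral_add
          ((by fun_prop : Continuous _).intervalIntegrable _ _)
          ((by fun_prop : Continuous _).intervalIntegrable _ _)]
      congr 1
      refine intervalIntegral.integral_congr fun θ _ => ?_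
      have h1 : (((h - 1 : ℤ) : ℝ) + 1) * θ = (h + 1) * θ - θ := by push_cast; ring
      have h2 : (((h + 1 : ℤ) : ℝ) + 1) * θ = (h + 1) * θ + θ := by push_cast; ring
      simp only [h1, h2, Real.sin_sub, Real.sin_add]
      ring

lemma isTopHeavyMoments_motzkinNumber :
    IsTopHeavyMoments fun n => (motzkinNumber n : ℝ) := by
  set f : ℝ → ENNReal := fun θ => ENNReal.ofReal (2 / Real.pi * Real.sin θ ^ 2) with hf
  have hfm : Measurable f := by fun_prop
  set ρ := volume.restrict (Set.Ioc 0 Real.pi) with hρ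
  set g : ℝ → ℝ := fun θ => 1 + 2 * Real.cos θ with hg
  have hgm : Measurable g := by fun_prop
  have hfin : IsFiniteMeasure (ρ.withDensity f) := by
    refine isFiniteMeasure_withDensity_ofReal ?_
    exact ((by fun_prop : Continuous fun θ : ℝ => 2 / Real.pi * Real.sin θ ^ 2).intervalIntegrable
      0 Real.pi).1.2
  refine ⟨(ρ.withDensity f).map g, 1, 3, inferInstance, zero_le_one, by norm_num, ?_, ?_, ?_⟩
  · refine (ae_map_iff hgm.aemeasurable measurableSet_Icc).2 ?_
    refine .of_forall fun θ => ⟨?_, ?_⟩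
    · linarith [Real.neg_one_le_cos θ]
    · linarith [Real.cos_le_one θ]
  · intro c hc
    rw [Measure.map_apply hgm measurableSet_Ioo, pos_iff_ne_zero, Ne,
      withDensity_apply_eq_zero hfm]
    intro h0
    have hcont : ContinuousAt g 0 := by fun_prop
    have hev : ∀ᶠ θ in 𝓝 (0 : ℝ), c < g θ :=
      hcont.eventually (lt_mem_nhds (by simp [hg]; linarith))
    obtain ⟨ε, hε, hball⟩ := Metric.eventually_nhds_iff.1 hev
    have hδ : 0 < min ε Real.pi := lt_min hε Real.pi_pos
    -- Small `θ > 0` gives `g θ` close to `3` but strictly below, with `sin θ ≠ 0`.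
    have hsub : Set.Ioo 0 (min ε Real.pi) ⊆ {θ | f θ ≠ 0} ∩ g ⁻¹' Set.Ioo c 3 := by
      rintro θ ⟨h1, h2⟩
      have h3 := h2.trans_le (min_le_right _ _)
      refine ⟨?_, hball ?_, ?_⟩
      · have := Real.sin_pos_of_pos_of_lt_pi h1 h3
        have : 0 < 2 / Real.pi * Real.sin θ ^ 2 := by positivity
        simpa only [hf, Set.mem_ofPred_eq, Ne, ENNReal.ofReal_eq_zero, not_le] using this
      · rw [Real.dist_eq, sub_zero, abs_of_pos h1]
        exact h2.trans_le (min_le_left _ _)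
      · have : Real.cos θ < Real.cos 0 :=
          Real.cos_lt_cos_of_nonneg_of_le_pi le_rfl h3.le h1
        rw [Real.cos_zero] at this
        simp only [hg]
        linarith
    have := measure_mono_null hsub h0
    have hIoc : Set.Ioo 0 (min ε Real.pi) ⊆ Set.Ioc 0 Real.pi := fun θ hθ =>
      ⟨hθ.1, (hθ.2.trans_le (min_le_right _ _)).le⟩
    rw [hρ, Measure.restrict_eq_self _ hIoc, Real.volume_Ioo] at this
    simp only [sub_zero, ENNReal.ofReal_eq_zero] at this
    exact this.not_gt hδ
  · intro n
    rw [integral_map hgm.aemeasurable (by fun_prop),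
      integral_withDensity_eq_integral_toReal_smul hfm (by simp [hf]),
      show (fun n => (motzkinNumber n : ℝ)) n = motzkinCount n 0 by rw [motzkinCount_zero_right],
      motzkinCount_eq_integral n (by norm_num),
      intervalIntegral.integral_of_le Real.pi_pos.le, ← integral_const_mul]
    refine integral_congr_ae (.of_forall fun θ => ?_)
    simp only [hf, hg, smul_eq_mul]
    rw [ENNReal.toReal_ofReal (by positivity)]
    simp
    ring

theorem mainTheorem3 (r : ℕ) (hr : 0 < r) :
    AsymptoticallyRLogConvex r (fun n => (motzkinNumber n : ℝ)) := by
  have h : ∀ᶠ n in atTop, ∀ k ∈ Set.Icc 1 r,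
      0 ≤ (logConvOp^[k] fun n => (motzkinNumber n : ℝ)) n :=
    -- Finitely many `k` allow a common threshold `N`.
    (eventually_all_finite (Set.finite_Icc 1 r)).2 fun k _ =>
      (isTopHeavyMoments_motzkinNumber.iterate_logConvOp k).eventually_nonneg
  obtain ⟨N, hN⟩ := eventually_atTop.1 h
  exact ⟨N, fun n hn k hk hkr => hN n hn k ⟨hk, hkr⟩⟩
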